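/- Let $\mathcal G=(\mathcal V,\mathcal E,\mathcal W)$ be a finite connected undirected simple graph with nonzero real (possibly negative) edge weights $\mathcal W:\mathcal E\to\mathbb R\setminus\{0\}$, let $W=\operatorname{diag}(\mathcal W(e))_{e\in\mathcal E}$, fix an arbitrary orientation of the edges, and let $E\in\mathbb R^{|\mathcal V|\times|\mathcal E|}$ be the corresponding incidence matrix (the column of an edge has entry $1$ at its tail, $-1$ at its head and $0$ elsewhere). Let $L(\mathcal G)=EWE^T$ be the weighted Laplacian, and assume that its signature is $\sigma(L(\mathcal G))=(n_+,n_-,1)$ for some $n_+,n_-$, i.e. it has $n_+$ positive, $n_-$ negative and exactly one zero eigenvalue, counted with multiplicity. Let $\mathcal T\subseteq\mathcal G$ be a spanning tree and $\mathcal C=\mathcal G\setminus\mathcal T$ the subgraph of the remaining edges; order the edges so that $E=[\,E_{\mathcal T}\ \ E_{\mathcal C}\,]$. Put $$L_e(\mathcal T)=E_{\mathcal T}^TE_{\mathcal T},\quad E_{\mathcal T}^L=L_e(\mathcal T)^{-1}E_{\mathcal T}^T,\quad R=[\,I\ \ E_{\mathcal T}^LE_{\mathcal C}\,],\quad L_{ess}(\mathcal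 T)=L_e(\mathcal T)\,RWR^T .$$ Then $L_e(\mathcal T)$, $RWR^T$ and $L_{ess}(\mathcal T)$ are invertible, $E_{\mathcal T}^L$ is a left inverse of $E_{\mathcal T}$, that is $E_{\mathcal T}^LE_{\mathcal T}=I$, and the Moore–Penrose pseudo-inverse of the weighted Laplacian is $$L^\dagger(\mathcal G)=(E_{\mathcal T}^L)^T\,(RWR^T)^{-1}\,E_{\mathcal T}^L=(E_{\mathcal T}^L)^T\,L_{ess}(\mathcal T)^{-1}\,E_{\mathcal T}^T .$$ Consequently, for all nodes $u,v\in\mathcal V$, the effective resistance $\mathcal R_{uv}(\mathcal G):=(\mathbf e_u-\mathbf e_v)^TL^\dagger(\mathcal G)(\mathbf e_u-\mathbf e_v)$, where $\mathbf e_u$ is the indicator vector of $u$, satisfies $$\mathcal R_{uv}(\mathcal G)=(\mathbf e_u-\mathbf e_v)^T(E_{\mathcal T}^L)^T(RWR^T)^{-1}E_{\mathcal T}^L(\mathbf e_u-\mathbf e_v).$$ -/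

import Mathlib

open Matrix

namespace SignedLaplacian

section PseudoInverse

variable {m n : Type*} [Fintype m] [Fintype n]

/-- The four Penrose equations: `X` is a Moore–Penrose pseudo-inverse of the real matrix `A`. -/
structure IsMoorePenrose (A : Matrix m n ℝ) (X : Matrix n m ℝ) : Prop where
  mul_mul_self : A * X * A = A
  self_mul_mul : X * A * X = X
  symm_left : (A * X)ᵀ = A * X
  symm_right : (X * A)ᵀ = X * A

theorem IsMoorePenrose.unique {A : Matrix m n ℝ} {X Y : Matrix n m ℝ}
    (hX : IsMoorePenrose A X) (hY : IsMoorePenrose A Y) : X = Y := by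
  have hA : A * X = A * Y := by
    calc A * X = (A * X)ᵀ := hX.symm_left.symm
      _ = (A * Y * A * X)ᵀ := by rw [hY.mul_mul_self]
      _ = (A * X)ᵀ * (A * Y)ᵀ := by rw [← transpose_mul]; simp only [Matrix.mul_assoc]
      _ = A * X * A * Y := by rw [hX.symm_left, hY.symm_left]; simp only [Matrix.mul_assoc]
      _ = A * Y := by rw [hX.mul_mul_self]
  have hB : X * A = Y * A := by
    calc X * A = (X * A)ᵀ := hX.symm_right.symm
      _ = (X * (A * Y * A))ᵀ := by rw [hY.mul_mul_self]
      _ = (Y * A)ᵀ * (X * A)ᵀ := by rw [← transpose_mul]; simp only [Matrix.mul_assoc]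
      _ = Y * (A * X * A) := by rw [hX.symm_right, hY.symm_right]; simp only [Matrix.mul_assoc]
      _ = Y * A := by rw [hX.mul_mul_self]
  calc X = X * A * X := hX.self_mul_mul.symm
    _ = Y * (A * Y) := by rw [hB, Matrix.mul_assoc, hA]
    _ = Y := by rw [← Matrix.mul_assoc, hY.self_mul_mul]

/-- Symmetric real matrices have a symmetric Moore–Penrose pseudo-inverse. -/
theorem exists_isMoorePenrose_of_isHermitian [DecidableEq n] {H : Matrix n n ℝ}
    (hH : H.IsHermitian) : ∃ X : Matrix n n ℝ, IsMoorePenrose H X ∧ Xᵀ = X := by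
  obtain ⟨U, d, hU, hHU⟩ : ∃ (U : Matrix n n ℝ) (d : n → ℝ),
      Uᵀ * U = 1 ∧ H = U * diagonal d * Uᵀ := by
    refine ⟨hH.eigenvectorUnitary, hH.eigenvalues, ?_, ?_⟩
    · have := Unitary.coe_star_mul_self hH.eigenvectorUnitary
      simpa [star_eq_conjTranspose, conjTranspose_eq_transpose_of_trivial] using this
    · have := hH.spectral_theorem
      simpa [Unitary.conjStarAlgAut_apply, star_eq_conjTranspose,
        conjTranspose_eq_transpose_of_trivial, Function.comp_def] using this
  have key : ∀ a b : n → ℝ, (U * diagonal a * Uᵀ) * (U * diagonal b * Uᵀ)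
      = U * diagonal (fun i => a i * b i) * Uᵀ := by
    intro a b
    calc _ = U * diagonal a * (Uᵀ * U) * diagonal b * Uᵀ := by simp only [Matrix.mul_assoc]
      _ = _ := by rw [hU, Matrix.mul_one, Matrix.mul_assoc U, diagonal_mul_diagonal]
  have tr : ∀ a : n → ℝ, (U * diagonal a * Uᵀ)ᵀ = U * diagonal a * Uᵀ := by
    intro a; simp [transpose_mul, Matrix.mul_assoc]
  refine ⟨U * diagonal (fun i => (d i)⁻¹) * Uᵀ, ⟨?_, ?_, ?_, ?_⟩, tr _⟩
  · rw [hHU, key, key]; congr 3; ext i; exact mul_inv_mul_cancel (d i)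
  · rw [hHU, key, key]; congr 3; ext i; rw [mul_assoc]; by_cases h : d i = 0 <;> simp [h]
  · rw [hHU, key, tr]
  · rw [hHU, key, tr]

theorem exists_isMoorePenrose (A : Matrix m n ℝ) : ∃ X : Matrix n m ℝ, IsMoorePenrose A X := by
  classical
  have hH : (Aᵀ * A).IsHermitian := by
    simp [IsHermitian, conjTranspose_eq_transpose_of_trivial, transpose_mul]
  obtain ⟨G, hG, hGt⟩ := exists_isMoorePenrose_of_isHermitian hH
  have hz : A * (1 - G * (Aᵀ * A)) = 0 := by
    apply conjTranspose_mul_self_eq_zero.1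
    rw [conjTranspose_eq_transpose_of_trivial, transpose_mul]
    have : Aᵀ * (A * (1 - G * (Aᵀ * A))) = 0 := by
      rw [Matrix.mul_sub, Matrix.mul_sub, Matrix.mul_one, sub_eq_zero]
      calc Aᵀ * A = Aᵀ * A * G * (Aᵀ * A) := hG.mul_mul_self.symm
        _ = _ := by simp only [Matrix.mul_assoc]
    rw [Matrix.mul_assoc, this, Matrix.mul_zero]
  refine ⟨G * Aᵀ, ⟨?_, ?_, ?_, ?_⟩⟩
  · rw [Matrix.mul_sub, Matrix.mul_one, sub_eq_zero] at hz
    conv_rhs => rw [hz]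
    simp only [Matrix.mul_assoc]
  · conv_rhs => rw [← hG.self_mul_mul]
    simp only [Matrix.mul_assoc]
  · simp [transpose_mul, hGt, Matrix.mul_assoc]
  · have := hG.symm_right
    rwa [← Matrix.mul_assoc] at this

/-- The Moore–Penrose pseudo-inverse `A†` of a real matrix. -/
noncomputable def pinv (A : Matrix m n ℝ) : Matrix n m ℝ :=
  Classical.choose (exists_isMoorePenrose A)

theorem pinv_spec (A : Matrix m n ℝ) : IsMoorePenrose A (pinv A) :=
  Classical.choose_spec (exists_isMoorePenrose A)

/-- The signature `σ(A) = (n₊, n₋, n₀)` of a real symmetric matrix: the numbers of positive,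
negative and zero eigenvalues, counted with multiplicity. -/
noncomputable def signature [DecidableEq n] (A : Matrix n n ℝ) (hA : A.IsHermitian) : ℕ × ℕ × ℕ :=
  ((Finset.univ.filter fun i => 0 < hA.eigenvalues i).card,
   (Finset.univ.filter fun i => hA.eigenvalues i < 0).card,
   (Finset.univ.filter fun i => hA.eigenvalues i = 0).card)

end PseudoInverse

section Graph

variable {V : Type*}

/-- An orientation of the edges of an undirected graph. -/
structure Orientation (G : SimpleGraph V) where
  tail : G.edgeSet → V
  head : G.edgeSet → V
  mk_tail_head : ∀ e, s(tail e, head e) = (e : Sym2 V)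

/-- The orientation that a subgraph inherits. -/
def Orientation.restrict {G H : SimpleGraph V} (o : Orientation G) (h : H ≤ G) :
    Orientation H where
  tail e := o.tail ⟨e, SimpleGraph.edgeSet_mono h e.2⟩
  head e := o.head ⟨e, SimpleGraph.edgeSet_mono h e.2⟩
  mk_tail_head e := o.mk_tail_head ⟨e, SimpleGraph.edgeSet_mono h e.2⟩

variable [DecidableEq V]

/-- The (oriented) incidence matrix `E(G)`, of size `|V| × |E|`. -/
def incidence {G : SimpleGraph V} (o : Orientation G) : Matrix V G.edgeSet ℝ :=
  Matrix.of fun v e => if v = o.tail e then 1 else if v = o.head e then -1 else 0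

/-- The weighted Laplacian `L(G) = E W Eᵀ`, with `W` the diagonal matrix of the edge weights. -/
def laplacian [Fintype V] {G : SimpleGraph V} [DecidableRel G.Adj] (o : Orientation G)
    (w : G.edgeSet → ℝ) : Matrix V V ℝ :=
  incidence o * diagonal w * (incidence o)ᵀ

theorem laplacian_isHermitian [Fintype V] {G : SimpleGraph V} [DecidableRel G.Adj]
    (o : Orientation G) (w : G.edgeSet → ℝ) : (laplacian o w).IsHermitian := by
  simp [IsHermitian, laplacian, conjTranspose_eq_transpose_of_trivial, transpose_mul,
    Matrix.mul_assoc]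

/-- The effective resistance `(e_u - e_v)ᵀ L† (e_u - e_v)` between two nodes. -/
noncomputable def effectiveResistance [Fintype V] {G : SimpleGraph V} [DecidableRel G.Adj]
    (o : Orientation G) (w : G.edgeSet → ℝ) (u v : V) : ℝ :=
  (Pi.single u 1 - Pi.single v 1) ⬝ᵥ
    (pinv (laplacian o w) *ᵥ (Pi.single u 1 - Pi.single v 1))

variable [Fintype V] {G T : SimpleGraph V} [DecidableRel T.Adj]

/-- The edge Laplacian `L_e(T) = E_Tᵀ E_T` of an (unweighted) oriented graph. -/
def edgeLaplacian (o : Orientation T) : Matrix T.edgeSet T.edgeSet ℝ :=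
  (incidence o)ᵀ * incidence o

/-- The matrix `E_T^L = L_e(T)⁻¹ E_Tᵀ`. -/
noncomputable def leftInverse (o : Orientation T) : Matrix T.edgeSet V ℝ :=
  (edgeLaplacian o)⁻¹ * (incidence o)ᵀ

/-- The edges of `G` are those of the subgraph `T` followed by those of the cycle subgraph
`C = G \ T`. -/
def edgeSplit (h : T ≤ G) : T.edgeSet ⊕ (G \ T).edgeSet ≃ G.edgeSet :=
  (Equiv.sumCongr (Equiv.refl _) (Equiv.setCongr (SimpleGraph.edgeSet_sdiff G T))).trans
    (Equiv.Set.sumDiffSubset (SimpleGraph.edgeSet_mono h))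

/-- `R = [I  L_e(T)⁻¹ E_Tᵀ E_C]`, with columns indexed by the edges of `G`. -/
noncomputable def cutMatrix (o : Orientation G) (h : T ≤ G) : Matrix T.edgeSet G.edgeSet ℝ :=
  (fromCols 1 ((edgeLaplacian (o.restrict h))⁻¹ * (incidence (o.restrict h))ᵀ *
    incidence (o.restrict (sdiff_le : G \ T ≤ G)))).submatrix id (edgeSplit h).symm

/-- The matrix `R W Rᵀ`. -/
noncomputable def weightedCutGram [DecidableRel G.Adj] (o : Orientation G) (w : G.edgeSet → ℝ)
    (h : T ≤ G) : Matrix T.edgeSet T.edgeSet ℝ :=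
  cutMatrix o h * diagonal w * (cutMatrix o h)ᵀ

/-- The essential edge Laplacian `L_ess(T) = L_e(T) R W Rᵀ`. -/
noncomputable def essentialEdgeLaplacian [DecidableRel G.Adj] (o : Orientation G)
    (w : G.edgeSet → ℝ) (h : T ≤ G) : Matrix T.edgeSet T.edgeSet ℝ :=
  edgeLaplacian (o.restrict h) * weightedCutGram o w h

end Graph

end SignedLaplacian

/-! The kernel of `E_Tᵀ` is the constant vectors, because the tree is connected, and these are
killed by every `Eᵀ`. So the orthogonal projection `E_T E_T^L` onto the columns of `E_T` fixes all
incidence columns, which gives `E = E_T R` (`incidence_mul_cutMatrix`) and `L = E_T (R W Rᵀ) E_Tᵀ`.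
Signs of weights enter only through invertibility of `R W Rᵀ`: it has size `|V| - 1`, and the simple
zero eigenvalue gives `L` that very rank (`isUnit_weightedCutGram`). Then
`isMoorePenrose_mul_mul_transpose` inverts the factors one by one, and uniqueness identifies the
result with `pinv`. -/

namespace SignedLaplacian

/-! ### Pseudo-inverses of factored matrices; rank and signature -/

section PseudoInverse

variable {m n : Type*} [Fintype m] [Fintype n] [DecidableEq n]

/-- If `B` is a left inverse of `A` with `A * B` symmetric, and `N` is an invertible square matrix,
then `Bᵀ * N⁻¹ * B` is the Moore–Penrose pseudo-inverse of `A * N * Aᵀ`. -/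
theorem isMoorePenrose_mul_mul_transpose {A : Matrix m n ℝ} {B : Matrix n m ℝ} {N : Matrix n n ℝ}
    (hBA : B * A = 1) (hAB : (A * B)ᵀ = A * B) (hN : IsUnit N) :
    IsMoorePenrose (A * N * Aᵀ) (Bᵀ * N⁻¹ * B) := by
  have hdet : IsUnit N.det := (isUnit_iff_isUnit_det N).1 hN
  have hAtBt : Aᵀ * Bᵀ = 1 := by rw [← transpose_mul, hBA, transpose_one]
  -- Both products collapse to the same projection `A * B`; the second one needs its symmetry.
  have hl : A * N * Aᵀ * (Bᵀ * N⁻¹ * B) = A * B := by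
    calc _ = A * N * (Aᵀ * Bᵀ) * N⁻¹ * B := by simp only [Matrix.mul_assoc]
      _ = A * (N * N⁻¹) * B := by rw [hAtBt, Matrix.mul_one]; simp only [Matrix.mul_assoc]
      _ = A * B := by rw [mul_nonsing_inv N hdet, Matrix.mul_one]
  have hr : Bᵀ * N⁻¹ * B * (A * N * Aᵀ) = A * B := by
    calc _ = Bᵀ * N⁻¹ * (B * A) * N * Aᵀ := by simp only [Matrix.mul_assoc]
      _ = Bᵀ * (N⁻¹ * N) * Aᵀ := by rw [hBA, Matrix.mul_one]; simp only [Matrix.mul_assoc]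
      _ = A * B := by rw [nonsing_inv_mul N hdet, Matrix.mul_one, ← transpose_mul, hAB]
  refine ⟨?_, ?_, ?_, ?_⟩
  · rw [hl]
    calc _ = A * (B * A) * N * Aᵀ := by simp only [Matrix.mul_assoc]
      _ = _ := by rw [hBA, Matrix.mul_one]
  · rw [hr, ← hAB, transpose_mul]
    calc _ = Bᵀ * (Aᵀ * Bᵀ) * N⁻¹ * B := by simp only [Matrix.mul_assoc]
      _ = _ := by rw [hAtBt, Matrix.mul_one]
  · rw [hl, hAB]
  · rw [hr, hAB]

theorem isUnit_of_card_le_rank {N : Matrix n n ℝ} (h : Fintype.card n ≤ N.rank) : IsUnit N := by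
  rw [← linearIndependent_cols_iff_isUnit, linearIndependent_iff_card_eq_finrank_span,
    Set.finrank, ← rank_eq_finrank_span_cols]
  exact le_antisymm h N.rank_le_card_width

theorem rank_add_signature_zero (A : Matrix n n ℝ) (hA : A.IsHermitian) :
    A.rank + (signature A hA).2.2 = Fintype.card n := by
  rw [hA.rank_eq_card_non_zero_eigs, Fintype.card_subtype, signature, add_comm]
  exact Finset.card_filter_add_card_filter_not (s := Finset.univ) (fun i => hA.eigenvalues i = 0)

end PseudoInverse

/-! ### Incidence matrices of connected graphs and trees -/

section Graph

variable {V : Type*}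

theorem Orientation.tail_ne_head {G : SimpleGraph V} (o : Orientation G) (e : G.edgeSet) :
    o.tail e ≠ o.head e := by
  have h := e.2
  rw [← o.mk_tail_head e, SimpleGraph.mem_edgeSet] at h
  exact h.ne

variable [DecidableEq V] [Fintype V]

theorem incidence_transpose_mulVec {G : SimpleGraph V} (o : Orientation G) (x : V → ℝ)
    (e : G.edgeSet) : ((incidence o)ᵀ *ᵥ x) e = x (o.tail e) - x (o.head e) := by
  have h : ∀ v, incidence o v e * x v =
      (if v = o.tail e then x v else 0) - (if v = o.head e then x v else 0) := by
    intro v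
    have := o.tail_ne_head e
    simp only [incidence, of_apply]
    by_cases h₁ : v = o.tail e
    · have h₂ : v ≠ o.head e := h₁ ▸ this
      simp [h₂, if_pos h₁]
    · by_cases h₂ : v = o.head e
      · simp [h₁, if_pos h₂]
      · simp [h₁, h₂]
  simp [mulVec, dotProduct, h, Finset.sum_sub_distrib]

theorem incidence_transpose_mulVec_eq_zero {G : SimpleGraph V} (o : Orientation G) {x : V → ℝ}
    (h : ∀ u v, x u = x v) : (incidence o)ᵀ *ᵥ x = 0 := by
  ext e
  rw [incidence_transpose_mulVec, h (o.tail e) (o.head e), sub_self, Pi.zero_apply]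

theorem eq_of_incidence_transpose_mulVec_eq_zero {G : SimpleGraph V} (o : Orientation G)
    (hG : G.Connected) {x : V → ℝ} (hx : (incidence o)ᵀ *ᵥ x = 0) (u v : V) : x u = x v := by
  have hadj : ∀ a b, G.Adj a b → x a = x b := by
    intro a b hab
    have he := o.mk_tail_head ⟨s(a, b), hab⟩
    have h := congrFun hx ⟨s(a, b), hab⟩
    rw [incidence_transpose_mulVec, Pi.zero_apply, sub_eq_zero] at h
    rcases Sym2.eq_iff.1 he with ⟨h₁, h₂⟩ | ⟨h₁, h₂⟩
    · rwa [h₁, h₂] at h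
    · rw [h₁, h₂] at h
      exact h.symm
  obtain ⟨p⟩ := hG u v
  induction p with
  | nil => rfl
  | cons hab _ ih => exact (hadj _ _ hab).trans ih

/-- Rank-nullity for the transpose, whose kernel is spanned by the all-ones vector. -/
theorem card_le_rank_incidence_add_one {G : SimpleGraph V} [DecidableRel G.Adj] (o : Orientation G)
    (hG : G.Connected) : Fintype.card V ≤ (incidence o).rank + 1 := by
  have hker : Module.finrank ℝ (LinearMap.ker (incidence o)ᵀ.mulVecLin) ≤ 1 := by
    obtain ⟨r⟩ := hG.nonempty
    refine finrank_le_one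
      ⟨1, incidence_transpose_mulVec_eq_zero o (x := 1) fun _ _ => rfl⟩ fun y => ⟨y.1 r, ?_⟩
    ext v
    simpa using eq_of_incidence_transpose_mulVec_eq_zero o hG (LinearMap.mem_ker.1 y.2) r v
  have := (incidence o)ᵀ.mulVecLin.finrank_range_add_finrank_ker
  rw [Module.finrank_fintype_fun_eq_card] at this
  rw [← rank_transpose, Matrix.rank]
  omega

variable {G T : SimpleGraph V}

theorem edgeLaplacian_transpose (o : Orientation T) : (edgeLaplacian o)ᵀ = edgeLaplacian o := by
  rw [edgeLaplacian, transpose_mul, transpose_transpose]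

variable [DecidableRel T.Adj]

/-- A tree has `|V| - 1` edges, so its incidence matrix has full column rank, and a real Gram matrix
keeps that rank. -/
theorem isUnit_edgeLaplacian (o : Orientation T) (hT : T.IsTree) : IsUnit (edgeLaplacian o) := by
  apply isUnit_of_card_le_rank
  rw [edgeLaplacian, rank_transpose_mul_self]
  have h₁ := card_le_rank_incidence_add_one o hT.connected
  have h₂ := hT.card_edgeFinset
  rw [SimpleGraph.edgeFinset_card] at h₂
  omega

theorem leftInverse_mul_incidence (o : Orientation T) (hT : T.IsTree) :
    leftInverse o * incidence o = 1 := by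
  rw [leftInverse, Matrix.mul_assoc]
  exact nonsing_inv_mul _ ((isUnit_iff_isUnit_det _).1 (isUnit_edgeLaplacian o hT))

theorem incidence_mul_leftInverse_transpose (o : Orientation T) :
    (incidence o * leftInverse o)ᵀ = incidence o * leftInverse o := by
  simp only [leftInverse, transpose_mul, transpose_transpose, transpose_nonsing_inv,
    edgeLaplacian_transpose, Matrix.mul_assoc]

/-- `E_T * E_T^L` is the orthogonal projection onto the column space of `E_T`, which contains the
columns of the incidence matrix of every graph on the same vertices. -/
theorem incidence_mul_leftInverse_mul_incidence {H : SimpleGraph V} (o : Orientation T)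
    (hT : T.IsTree) (o' : Orientation H) :
    incidence o * leftInverse o * incidence o' = incidence o' := by
  have hz : (incidence o)ᵀ * (1 - incidence o * leftInverse o) = 0 := by
    rw [← incidence_mul_leftInverse_transpose, Matrix.mul_sub, Matrix.mul_one, ← transpose_mul,
      Matrix.mul_assoc, leftInverse_mul_incidence o hT, Matrix.mul_one, sub_self]
  have hz' : (incidence o')ᵀ * (1 - incidence o * leftInverse o) = 0 := by
    -- Each column of the complementary projection lies in the kernel of `E_Tᵀ`, hence is constant.
    ext e v
    have hcol : (incidence o)ᵀ *ᵥ
        (fun u => (1 - incidence o * leftInverse o : Matrix V V ℝ) u v) = 0 := by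
      ext f
      exact congrFun (congrFun hz f) v
    exact congrFun (incidence_transpose_mulVec_eq_zero o'
      (eq_of_incidence_transpose_mulVec_eq_zero o hT.connected hcol)) e
  rw [← incidence_mul_leftInverse_transpose, Matrix.mul_sub, Matrix.mul_one, ← transpose_mul,
    sub_eq_zero] at hz'
  exact (transpose_injective hz').symm

theorem incidence_mul_cutMatrix (o : Orientation G) (hTG : T ≤ G) (hT : T.IsTree) :
    incidence (o.restrict hTG) * cutMatrix o hTG = incidence o := by
  have h : incidence (o.restrict hTG) * cutMatrix o hTG =
      (fromCols (incidence (o.restrict hTG))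
        (incidence (o.restrict (sdiff_le : G \ T ≤ G)))).submatrix id (edgeSplit hTG).symm := by
    have := incidence_mul_leftInverse_mul_incidence (o.restrict hTG) hT
      (o.restrict (sdiff_le : G \ T ≤ G))
    rw [leftInverse, Matrix.mul_assoc] at this
    have hcols := mul_fromCols (incidence (o.restrict hTG)) (1 : Matrix T.edgeSet T.edgeSet ℝ)
      ((edgeLaplacian (o.restrict hTG))⁻¹ * (incidence (o.restrict hTG))ᵀ *
        incidence (o.restrict (sdiff_le : G \ T ≤ G)))
    rw [Matrix.mul_one, this] at hcols
    rw [← hcols]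
    rfl
  rw [h]
  ext v e
  obtain ⟨f, rfl⟩ := (edgeSplit hTG).surjective e
  rw [submatrix_apply, Equiv.symm_apply_apply]
  -- Restricted orientations read tail and head from `o`, so the entries agree by definition.
  rcases f with f | f <;> rfl

/-! ### The signed Laplacian factored through the tree -/

variable [DecidableRel G.Adj]

theorem laplacian_eq_mul_weightedCutGram_mul (o : Orientation G) (w : G.edgeSet → ℝ) (hTG : T ≤ G)
    (hT : T.IsTree) :
    laplacian o w = incidence (o.restrict hTG) * weightedCutGram o w hTG *
      (incidence (o.restrict hTG))ᵀ := by
  rw [laplacian, ← incidence_mul_cutMatrix o hTG hT, weightedCutGram, transpose_mul]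
  simp only [Matrix.mul_assoc]

theorem isUnit_weightedCutGram (o : Orientation G) (w : G.edgeSet → ℝ) (hTG : T ≤ G)
    (hT : T.IsTree) (hsig : (signature (laplacian o w) (laplacian_isHermitian o w)).2.2 = 1) :
    IsUnit (weightedCutGram o w hTG) := by
  apply isUnit_of_card_le_rank
  have h₁ := rank_add_signature_zero _ (laplacian_isHermitian o w)
  have h₂ := hT.card_edgeFinset
  rw [SimpleGraph.edgeFinset_card] at h₂
  have h₃ : (laplacian o w).rank ≤ (weightedCutGram o w hTG).rank := by
    rw [laplacian_eq_mul_weightedCutGram_mul o w hTG hT]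
    exact (rank_mul_le_left _ _).trans (rank_mul_le_right _ _)
  -- Both `rank L + 1` and the number of tree edges plus one equal `|V|`.
  omega

theorem pinv_laplacian (o : Orientation G) (w : G.edgeSet → ℝ) (hTG : T ≤ G) (hT : T.IsTree)
    (hN : IsUnit (weightedCutGram o w hTG)) :
    pinv (laplacian o w) = (leftInverse (o.restrict hTG))ᵀ * (weightedCutGram o w hTG)⁻¹ *
      leftInverse (o.restrict hTG) := by
  refine (pinv_spec _).unique ?_
  rw [laplacian_eq_mul_weightedCutGram_mul o w hTG hT]
  exact isMoorePenrose_mul_mul_transpose (leftInverse_mul_incidence _ hT)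
    (incidence_mul_leftInverse_transpose _) hN

end Graph

end SignedLaplacian

theorem mainTheorem5 {V : Type*} [Fintype V] [DecidableEq V]
    (G T : SimpleGraph V) [DecidableRel G.Adj] [DecidableRel T.Adj]
    (o : SignedLaplacian.Orientation G) (w : G.edgeSet → ℝ) (hw : ∀ e, w e ≠ 0)
    (hG : G.Connected) (hTG : T ≤ G) (hT : T.IsTree) (nPos nNeg : ℕ)
    (hsig : SignedLaplacian.signature (SignedLaplacian.laplacian o w)
      (SignedLaplacian.laplacian_isHermitian o w) = (nPos, nNeg, 1)) :
    -- the inverses that occur are genuine, and `E_T^L` is a left inverse of `E_T`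
    IsUnit (SignedLaplacian.edgeLaplacian (o.restrict hTG)) ∧
    SignedLaplacian.leftInverse (o.restrict hTG) *
      SignedLaplacian.incidence (o.restrict hTG) = 1 ∧
    IsUnit (SignedLaplacian.weightedCutGram o w hTG) ∧
    IsUnit (SignedLaplacian.essentialEdgeLaplacian o w hTG) ∧
    -- the two expressions for the pseudo-inverse
    SignedLaplacian.pinv (SignedLaplacian.laplacian o w) =
      (SignedLaplacian.leftInverse (o.restrict hTG)).transpose *
        (SignedLaplacian.weightedCutGram o w hTG)⁻¹ *
        SignedLaplacian.leftInverse (o.restrict hTG) ∧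
    SignedLaplacian.pinv (SignedLaplacian.laplacian o w) =
      (SignedLaplacian.leftInverse (o.restrict hTG)).transpose *
        (SignedLaplacian.essentialEdgeLaplacian o w hTG)⁻¹ *
        (SignedLaplacian.incidence (o.restrict hTG)).transpose ∧
    -- the effective resistance
    ∀ u v : V, SignedLaplacian.effectiveResistance o w u v =
      (Pi.single u 1 - Pi.single v 1 : V → ℝ) ⬝ᵥ
        (((SignedLaplacian.leftInverse (o.restrict hTG)).transpose *
          (SignedLaplacian.weightedCutGram o w hTG)⁻¹ *
          SignedLaplacian.leftInverse (o.restrict hTG)) *ᵥ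
            (Pi.single u 1 - Pi.single v 1 : V → ℝ)) := by
  have hN := SignedLaplacian.isUnit_weightedCutGram o w hTG hT (by rw [hsig])
  have hM := SignedLaplacian.isUnit_edgeLaplacian (o.restrict hTG) hT
  have hp := SignedLaplacian.pinv_laplacian o w hTG hT hN
  refine ⟨hM, SignedLaplacian.leftInverse_mul_incidence _ hT, hN, hM.mul hN, hp, ?_, ?_⟩
  -- Reversing the inverse of the product puts `L_e(T)⁻¹` next to `E_Tᵀ`, which restores `E_T^L`.
  · rw [hp, SignedLaplacian.essentialEdgeLaplacian, Matrix.mul_inv_rev]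
    simp only [SignedLaplacian.leftInverse, Matrix.mul_assoc]
  · intro u v
    rw [SignedLaplacian.effectiveResistance, hp]
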